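/- Let $\mathbb I=[0,1]$, let $Q=\mathbb I^{\mathbb N}$ be the Hilbert cube with coordinates numbered by $\mathbb N=\{1,2,3,\dots\}$, and let $\pi_i:Q\to\mathbb I$ be the projection onto the $i$-th coordinate. Definitions. A \emph{continuum} is a nonempty compact connected Hausdorff space. A compact Hausdorff space is \emph{hereditarily indecomposable} if, whenever two continua in it meet, one of them is contained in the other. A closed set $L$ is a \emph{partition} between $A$ and $B$ if its complement is the union of two disjoint open sets, one containing $A$ and the other containing $B$. A family $\{(A_j,B_j):j\in J\}$ of pairs of disjoint closed sets is \emph{essential} if $\bigcap_{j\in J}L_j\neq\emptyset$ for every choice of partitions $L_j$ between $A_j$ and $B_j$. A compact Hausdorff space is \emph{infinite-dimensional} if it has an essential family of every finite cardinality $n$, and \emph{strongly infinite-dimensional} if it has an infinite essential family. A \emph{pliable foursome} in a space is a quadruple $(C,D,F,G)$ of closed sets with $C\cap D=C\cap F=D\cap G=\emptyset$. A family $\mathcal F$ of continuous functions from a space to $\mathbb I$ is \emph{pliable} if for every pliable foursome $(C,D,F,G)$ with $C,D\ne\emptyset$ there is an $f\in\mathcal F$ with $f[C]=\{0\}$, $f[G]\subseteq[0,\frac12]$,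 $f[F]\subseteq[\frac12,1]$ and $f[D]=\{1\}$. Fix numbers $0<y_1<y_2<\frac12<y_3<y_4<1$, and let $P\subseteq\mathbb I^2$ be the crooked partition with these levels, that is, the closure of the union of the five open rectangles $$(\tfrac17,\tfrac27)\times(0,y_4),\quad(\tfrac17,\tfrac47)\times(y_3,y_4),\quad(\tfrac37,\tfrac47)\times(y_1,y_4),\quad(\tfrac37,\tfrac67)\times(y_1,y_2),\quad(\tfrac57,\tfrac67)\times(y_1,1).$$ Theorem. Let $\{f_i:i\in\mathbb N\}$ be a pliable family of continuous functions for $Q$, let $u_i:Q\to\mathbb I^2$ be the map $u_i(x)=(\pi_{2i}(x),f_i(x))$, and let $X=\bigcap_{i=1}^\infty u_i^{-1}[P]$. Then $X$ is an infinite-dimensional hereditarily indecomposable compact space. Moreover, the traces of the odd-numbered faces, $$\bigl\{(\{x\in X:x_k=0\},\{x\in X:x_k=1\}):k\in\mathbb N\text{ odd}\bigr\},$$ form an essential family in $X$; so $X$ is even strongly infinite-dimensional. -/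

import Mathlib

open Set unitInterval

/-- `L` is a partition between `A` and `B` in `X`: a closed set whose complement is the union
of two disjoint open sets, one containing `A`, the other containing `B`. -/
def IsPartitionBetween {X : Type*} [TopologicalSpace X] (L A B : Set X) : Prop :=
  IsClosed L ∧ ∃ U V : Set X, IsOpen U ∧ IsOpen V ∧ Disjoint U V ∧ A ⊆ U ∧ B ⊆ V ∧ Lᶜ = U ∪ V

/-- The family of pairs `(A i, B i)` is essential: the pairs consist of disjoint closed sets, and
whenever `L i` is a partition between `A i` and `B i` for all `i`, the intersection of all `L i`
is nonempty. -/
def IsEssentialFamily {X : Type*} [TopologicalSpace X] {ι : Type*} (A B : ι → Set X) : Prop :=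
  (∀ i, IsClosed (A i) ∧ IsClosed (B i) ∧ Disjoint (A i) (B i)) ∧
    ∀ L : ι → Set X, (∀ i, IsPartitionBetween (L i) (A i) (B i)) → (⋂ i, L i).Nonempty

/-- `dim X = ∞`: there are essential families of every finite cardinality. -/
def InfiniteDimensional (X : Type*) [TopologicalSpace X] : Prop :=
  ∀ n : ℕ, ∃ A B : Fin n → Set X, IsEssentialFamily A B

/-- `X` possesses an infinite essential family. -/
def StronglyInfiniteDimensional.{u} (X : Type u) [TopologicalSpace X] : Prop :=
  ∃ (ι : Type u) (A B : ι → Set X), Infinite ι ∧ IsEssentialFamily A B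

/-- A hereditarily indecomposable compact Hausdorff space: whenever two continua in the space
meet, one is contained in the other. (`IsConnected` includes being nonempty.) -/
def HereditarilyIndecomposable (X : Type*) [TopologicalSpace X] : Prop :=
  CompactSpace X ∧ T2Space X ∧
    ∀ K L : Set X, IsCompact K → IsConnected K → IsCompact L → IsConnected L →
      (K ∩ L).Nonempty → K ⊆ L ∨ L ⊆ K

/-- Four closed sets `C`, `D`, `F`, `G` with `C ∩ D = C ∩ F = D ∩ G = ∅`. -/
def IsPliableFoursome {X : Type*} [TopologicalSpace X] (C D F G : Set X) : Prop :=
  IsClosed C ∧ IsClosed D ∧ IsClosed F ∧ IsClosed G ∧ C ∩ D = ∅ ∧ C ∩ F = ∅ ∧ D ∩ G = ∅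

/-- `f` is a Urysohn function for the foursome `(C, D, F, G)`. -/
def IsUrysohnFunction {X : Type*} [TopologicalSpace X] (f : C(X, I)) (C D F G : Set X) : Prop :=
  f '' C = {0} ∧ (∀ x ∈ G, (f x : ℝ) ≤ 1 / 2) ∧ (∀ x ∈ F, 1 / 2 ≤ (f x : ℝ)) ∧ f '' D = {1}

/-- A pliable family for `X`: it contains a Urysohn function for every pliable foursome
`(C, D, F, G)` with `C` and `D` nonempty (the images of `C` and `D` have to be the one-point sets
`{0}` and `{1}`). -/
def IsPliableFamily {X : Type*} [TopologicalSpace X] {ι : Type*} (f : ι → C(X, I)) : Prop :=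
  ∀ C D F G : Set X, IsPliableFoursome C D F G → C.Nonempty → D.Nonempty →
    ∃ i, IsUrysohnFunction (f i) C D F G

/-- The point `k / 7` of the unit interval. -/
noncomputable def seventh (k : Fin 8) : I :=
  ⟨((k : ℕ) : ℝ) / 7, by positivity, by
    have h : ((k : ℕ) : ℝ) ≤ 7 := by exact_mod_cast Nat.lt_succ_iff.mp k.isLt
    rw [div_le_one (by norm_num)]; exact h⟩

/-- The crooked partition of the square: the closure of the union of five open rectangles that
together form an N-shaped band. The band rises from the bottom edge over `(1/7, 2/7)` to the
height `y₄`, goes right at heights `(y₃, y₄)`, descends over `(3/7, 4/7)` to the height `y₁`, goes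
right at heights `(y₁, y₂)`, and rises over `(5/7, 6/7)` to the top edge. -/
def crookedPartition (y₁ y₂ y₃ y₄ : I) : Set (I × I) :=
  closure
    (Ioo (seventh 1) (seventh 2) ×ˢ Ioo 0 y₄ ∪
     Ioo (seventh 1) (seventh 4) ×ˢ Ioo y₃ y₄ ∪
     Ioo (seventh 3) (seventh 4) ×ˢ Ioo y₁ y₄ ∪
     Ioo (seventh 3) (seventh 6) ×ˢ Ioo y₁ y₂ ∪
     Ioo (seventh 5) (seventh 6) ×ˢ Ioo y₁ 1)

/-- The Hilbert cube, with coordinates numbered by the positive integers. -/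
abbrev HilbertCube : Type := ℕ+ → I

/-- The diagonal map of the projection onto the coordinate `2 * i` and `f i`. -/
def diagMap (f : ℕ+ → C(HilbertCube, I)) (i : ℕ+) : HilbertCube → I × I :=
  fun x => (x (2 * i), f i x)

/-- The intersection over all `i ≥ 1` of the preimages of `P` under the diagonal maps. -/
def bingCompactum (P : Set (I × I)) (f : ℕ+ → C(HilbertCube, I)) : Set HilbertCube :=
  ⋂ i : ℕ+, diagMap f i ⁻¹' P

/-- The trace on `Y` of the face where the coordinate `k` is `0`. -/
def faceZeroTrace (Y : Set HilbertCube) (k : ℕ+) : Set Y := {x | x.1 k = 0}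

/-- The trace on `Y` of the face where the coordinate `k` is `1`. -/
def faceOneTrace (Y : Set HilbertCube) (k : ℕ+) : Set Y := {x | x.1 k = 1}

/-! Essentiality. Opposite faces of a cube form an essential family
(`iInter_partitions_cube_nonempty`). Kuhn's parity lemma proves this in finite dimensions, and
compactness gives the rest. Each `u_i⁻¹[P]` is a partition between the faces of coordinate `2 * i`,
and partitions in `X` between traces of odd faces contain traces of partitions in the whole cube. A
common point of all these partitions lies in `X` and in every given partition.

Hereditary indecomposability. If continua `K` and `L` in `X` meet, with `p ∈ K \ L` and `q ∈ L \ K`,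
pliability gives an `f i` with value `0` at `p`, at most `1/2` on `K`, at least `1/2` on `L`, and
`1` at `q`. The lower half of the band `P` is disconnected, so `K`, which contains `p`, stays over
its first leg. Symmetrically `L` stays over its last leg. Hence `K` and `L` cannot meet. -/

/-! ### Kuhn's lemma on the Freudenthal triangulation. -/

/-- The `i`-th vertex of the simplex of the Freudenthal triangulation that starts at `v` and
increases the coordinate `c` at time `τ c`. -/
def freudenthalVertex {n : ℕ} (s : (Fin n → ℕ) × Equiv.Perm (Fin n)) (i : ℕ) : Fin n → ℕ :=
  fun c => s.1 c + if (s.2 c : ℕ) < i then 1 else 0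

theorem freudenthalVertex_mul {n : ℕ} (v : Fin n → ℕ) (p q : Equiv.Perm (Fin n)) (i : ℕ)
    (c : Fin n) :
    freudenthalVertex (v, p * q) i c = v c + if (p (q c) : ℕ) < i then 1 else 0 :=
  rfl

/-- The `m`-dimensional simplices of the triangulation of the face of the cube `[0, N] ^ n` where
all coordinates from `m` on vanish. -/
def freudenthalSimplices (n N m : ℕ) : Finset ((Fin n → ℕ) × Equiv.Perm (Fin n)) :=
  (Fintype.piFinset (fun _ => Finset.range (N + 1)) ×ˢ Finset.univ).filter fun s =>
    ∀ c : Fin n, ((c : ℕ) < m → s.1 c < N) ∧ (m ≤ (c : ℕ) → s.1 c = 0 ∧ s.2 c = c)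

theorem mem_freudenthalSimplices {n N m : ℕ} {s : (Fin n → ℕ) × Equiv.Perm (Fin n)} :
    s ∈ freudenthalSimplices n N m ↔
      ∀ c : Fin n, ((c : ℕ) < m → s.1 c < N) ∧ (m ≤ (c : ℕ) → s.1 c = 0 ∧ s.2 c = c) := by
  simp only [freudenthalSimplices, Finset.mem_filter, Finset.mem_product, Fintype.mem_piFinset,
    Finset.mem_range, Finset.mem_univ, and_true, and_iff_right_iff_imp]
  intro h c
  rcases lt_or_ge (c : ℕ) m with hc | hc
  · exact ((h c).1 hc).trans (Nat.lt_succ_self N)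
  · rw [((h c).2 hc).1]; exact Nat.succ_pos N

/-- In a simplex with labels `0, …, m + 1` the number of facets whose label set is `{0, …, m}` is
odd if and only if all labels occur. -/
theorem odd_card_facets_iff {m : ℕ} {g : ℕ → ℕ} (hg : ∀ i < m + 2, g i ≤ m + 1) :
    Odd ((Finset.range (m + 2)).filter fun i =>
        ((Finset.range (m + 2)).erase i).image g = Finset.range (m + 1)).card ↔
      (Finset.range (m + 2)).image g = Finset.range (m + 2) := by
  constructor
  -- If not all labels occur but deleting `i` leaves `{0, …, m}`, the label of `i` recurs at exactly
  -- one other vertex `j`. Precisely the deletions of `i` and `j` work, so the count is two.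
  · intro hodd
    by_contra hne
    obtain ⟨i, hi⟩ : ((Finset.range (m + 2)).filter fun i =>
        ((Finset.range (m + 2)).erase i).image g = Finset.range (m + 1)).Nonempty :=
      Finset.card_pos.1 hodd.pos
    obtain ⟨hi, him⟩ := Finset.mem_filter.1 hi
    have hins : insert i ((Finset.range (m + 2)).erase i) = Finset.range (m + 2) :=
      Finset.insert_erase hi
    have hgi : g i ≠ m + 1 := by
      intro h
      apply hne
      rw [← hins, Finset.image_insert, him, hins, h, Finset.range_add_one (n := m + 1)]
    have hgi' : g i ∈ Finset.range (m + 1) :=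
      Finset.mem_range.2 (lt_of_le_of_ne (hg i (Finset.mem_range.1 hi)) hgi)
    have hinj : Set.InjOn g ((Finset.range (m + 2)).erase i) := by
      apply Finset.card_image_iff.1
      rw [him, Finset.card_erase_of_mem hi]; simp
    rw [← him] at hgi'
    obtain ⟨j, hj, hji⟩ := Finset.mem_image.1 hgi'
    have hjr := Finset.mem_of_mem_erase hj
    have hjn := Finset.ne_of_mem_erase hj
    have hset : ((Finset.range (m + 2)).filter fun i =>
        ((Finset.range (m + 2)).erase i).image g = Finset.range (m + 1)) = {i, j} := by
      ext k
      simp only [Finset.mem_filter, Finset.mem_insert, Finset.mem_singleton]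
      constructor
      · rintro ⟨hk, hkm⟩
        by_contra! hkij
        have hkinj : Set.InjOn g ((Finset.range (m + 2)).erase k) := by
          apply Finset.card_image_iff.1
          rw [hkm, Finset.card_erase_of_mem hk]; simp
        exact hjn (hkinj (Finset.mem_coe.2 (Finset.mem_erase.2 ⟨hkij.2.symm, hjr⟩))
          (Finset.mem_coe.2 (Finset.mem_erase.2 ⟨hkij.1.symm, hi⟩)) hji)
      · rintro (rfl | rfl)
        · exact ⟨hi, him⟩
        · refine ⟨hjr, ?_⟩
          rw [← him]
          ext y
          simp only [Finset.mem_image, Finset.mem_erase]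
          constructor
          · rintro ⟨a, ⟨ha, har⟩, rfl⟩
            by_cases hai : a = i
            · exact ⟨k, ⟨hjn, hjr⟩, by rw [hai, hji]⟩
            · exact ⟨a, ⟨hai, har⟩, rfl⟩
          · rintro ⟨a, ⟨ha, har⟩, rfl⟩
            by_cases hak : a = k
            · exact ⟨i, ⟨fun h => hjn h.symm, hi⟩, by rw [hak, hji]⟩
            · exact ⟨a, ⟨hak, har⟩, rfl⟩
    rw [hset, Finset.card_pair (fun h => hjn h.symm)] at hodd
    exact absurd hodd (by decide)
  -- With all labels present `g` is injective, so only the vertex labelled `m + 1` can be deleted.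
  · intro hfull
    have hinj : Set.InjOn g (Finset.range (m + 2)) := by
      apply Finset.card_image_iff.1
      rw [hfull]
    have : m + 1 ∈ (Finset.range (m + 2)).image g := by rw [hfull]; simp
    obtain ⟨i, hi, him⟩ := Finset.mem_image.1 this
    have hset : ((Finset.range (m + 2)).filter fun i =>
        ((Finset.range (m + 2)).erase i).image g = Finset.range (m + 1)) = {i} := by
      ext k
      simp only [Finset.mem_filter, Finset.mem_singleton]
      constructor
      · rintro ⟨hk, hkm⟩
        by_contra hki
        have : g i ∈ ((Finset.range (m + 2)).erase k).image g :=
          Finset.mem_image_of_mem _ (Finset.mem_erase.2 ⟨fun h => hki h.symm, hi⟩)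
        rw [hkm, him] at this
        simp at this
      · rintro rfl
        refine ⟨hi, ?_⟩
        rw [Finset.erase_eq, Finset.image_sdiff_of_injOn hinj (by simpa using hi), hfull]
        simp only [Finset.image_singleton, him]
        ext y
        simp only [Finset.mem_sdiff, Finset.mem_range, Finset.mem_singleton]
        omega
    rw [hset]; simp

/-- A finite set with a fixed point free involution has even cardinality. -/
theorem Finset.even_card_of_involution {α : Type*} (s : Finset α) (g : α → α)
    (hmem : ∀ a ∈ s, g a ∈ s) (hne : ∀ a ∈ s, g a ≠ a) (hinv : ∀ a ∈ s, g (g a) = a) :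
    Even s.card := by
  have h : ∑ a ∈ s, (1 : ZMod 2) = 0 :=
    Finset.sum_involution (fun a _ => g a) (fun _ _ => by decide) (fun a ha _ => hne a ha)
      (fun a ha => hmem a ha) (fun a ha => hinv a ha)
  rw [Finset.sum_const, nsmul_eq_mul, mul_one] at h
  exact even_iff_two_dvd.2 ((ZMod.natCast_eq_zero_iff _ _).1 h)

section Facets

variable {n N m : ℕ} {l : (Fin n → ℕ) → ℕ}

/-- The simplices for which the facet opposite to the vertex `i` has label set `{0, …, m}`. -/
def labelledFacets (N m : ℕ) (l : (Fin n → ℕ) → ℕ) (i : ℕ) :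
    Finset ((Fin n → ℕ) × Equiv.Perm (Fin n)) :=
  (freudenthalSimplices n N (m + 1)).filter fun s =>
    ((Finset.range (m + 2)).erase i).image (fun j => l (freudenthalVertex s j)) =
      Finset.range (m + 1)

/-- Exchanging the steps at times `i - 1` and `i` changes only vertex `i`. This pairs the two
simplices sharing the facet. -/
theorem even_card_labelledFacets (hm : m < n) {i : ℕ} (hi : 0 < i) (him : i < m + 1) :
    Even (labelledFacets N m l i).card := by
  obtain ⟨k, rfl⟩ : ∃ k, i = k + 1 := ⟨i - 1, by omega⟩
  set p : Equiv.Perm (Fin n) := Equiv.swap ⟨k, by omega⟩ ⟨k + 1, by omega⟩ with hp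
  have hne : (⟨k, by omega⟩ : Fin n) ≠ ⟨k + 1, by omega⟩ := by simp
  have hlt : ∀ (d : Fin n) (j : ℕ), j ≠ k + 1 → ((p d : ℕ) < j ↔ (d : ℕ) < j) := by
    intro d j hj
    rw [hp, Equiv.swap_apply_def]
    split_ifs with h1 h2
    · subst h1; simp only; omega
    · subst h2; simp only; omega
    · rfl
  apply Finset.even_card_of_involution _ (fun s => (s.1, p * s.2))
  · intro s hs
    obtain ⟨hs, hl⟩ := Finset.mem_filter.1 hs
    refine Finset.mem_filter.2 ⟨?_, ?_⟩
    · rw [mem_freudenthalSimplices] at hs ⊢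
      refine fun c => ⟨(hs c).1, fun hc => ⟨((hs c).2 hc).1, ?_⟩⟩
      rw [Equiv.Perm.mul_apply, ((hs c).2 hc).2, hp]
      apply Equiv.swap_apply_of_ne_of_ne <;>
      · intro h; rw [Fin.ext_iff] at h; simp only at h; omega
    · rw [← hl]
      apply Finset.image_congr
      intro j hj
      have hj := Finset.ne_of_mem_erase (Finset.mem_coe.1 hj)
      simp only
      congr 1
      funext c
      simp only [freudenthalVertex, Equiv.Perm.mul_apply, hlt _ j hj]
  · intro s _ h
    have h := (Prod.ext_iff.1 h).2
    simp only [mul_eq_right] at h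
    exact hne (Equiv.swap_eq_one_iff.1 h)
  · intro s _
    simp [← mul_assoc, hp]

/-- The facet opposite vertex `0` is the facet opposite the last vertex of the simplex that starts
at vertex `1` and takes the first step last. By `h1` this neighbour stays in the grid: a facet in `x
c = N` lacks the label `c`. The move can be undone exactly when the base is positive in the
direction of the last step. -/
theorem card_labelledFacets_zero (hm : m < n) (h1 : ∀ x (c : Fin n), x c = N → l x ≠ c) :
    (labelledFacets N m l 0).card =
      ((labelledFacets N m l (m + 1)).filter fun s => 0 < s.1 (s.2.symm ⟨m, hm⟩)).card := by
  have hn : 0 < n := by omega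
  -- `r` sends time `m` to `0` and raises earlier times by one, so `r.symm` postpones the first step
  -- to the end.
  set r : Equiv.Perm (Fin n) := Fin.cycleRange ⟨m, hm⟩ with hr
  have hrgt : ∀ d : Fin n, m < (d : ℕ) → r d = d := fun d hd => Fin.cycleRange_of_gt hd
  have hrlt : ∀ d : Fin n, (d : ℕ) < m → (r d : ℕ) = d + 1 := fun d hd =>
    Fin.coe_cycleRange_of_lt (i := d) (j := ⟨m, hm⟩) hd
  have : NeZero n := ⟨by omega⟩
  have hrm : (r ⟨m, hm⟩) = 0 := Fin.cycleRange_self _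
  have hr0 : r.symm 0 = ⟨m, hm⟩ := by rw [← hrm, Equiv.symm_apply_apply]
  have hrsgt : ∀ d : Fin n, m < (d : ℕ) → r.symm d = d := fun d hd => by
    rw [Equiv.symm_apply_eq, hrgt d hd]
  have hrs : ∀ d : Fin n, 0 < (d : ℕ) → (d : ℕ) ≤ m → (r.symm d : ℕ) + 1 = d := by
    intro d hd hdm
    have h : r ⟨d - 1, by omega⟩ = d := Fin.ext (by rw [hrlt _ (by simp only; omega)]; simp only; omega)
    conv_lhs => rw [← h]
    rw [Equiv.symm_apply_apply]; simp only; omega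
  have himg : ∀ a b : ℕ → ℕ, (∀ j < m + 1, b j = a (j + 1)) →
      ((Finset.range (m + 2)).erase 0).image a = ((Finset.range (m + 2)).erase (m + 1)).image b := by
    intro a b hab
    ext y
    simp only [Finset.mem_image, Finset.mem_erase, Finset.mem_range]
    constructor
    · rintro ⟨j, ⟨hj0, hj⟩, rfl⟩
      refine ⟨j - 1, ⟨by omega, by omega⟩, ?_⟩
      rw [hab _ (by omega)]; congr 1; omega
    · rintro ⟨j, ⟨hj0, hj⟩, rfl⟩
      exact ⟨j + 1, ⟨by omega, by omega⟩, (hab _ (by omega)).symm⟩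
  have hvert : ∀ s : (Fin n → ℕ) × Equiv.Perm (Fin n), ∀ j < m + 1,
      freudenthalVertex (freudenthalVertex s 1, r.symm * s.2) j = freudenthalVertex s (j + 1) := by
    intro s j hj
    funext c
    rw [freudenthalVertex_mul]
    simp only [freudenthalVertex]
    rcases Nat.eq_zero_or_pos (s.2 c : ℕ) with h0 | h0
    · have : s.2 c = 0 := Fin.ext h0
      rw [this, hr0, Fin.val_zero]
      rw [if_pos (by omega), if_neg (by simp only; omega), if_pos (by omega)]
    · rcases le_or_gt (s.2 c : ℕ) m with h2 | h2
      · have := hrs _ h0 h2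
        rw [if_neg (by omega)]
        by_cases h3 : (s.2 c : ℕ) < j + 1
        · rw [if_pos h3, if_pos (by omega)]
        · rw [if_neg h3, if_neg (by omega)]
      · rw [hrsgt _ h2, if_neg (by omega), if_neg (by omega), if_neg (by omega)]
  have hback : ∀ s : (Fin n → ℕ) × Equiv.Perm (Fin n), 0 < s.1 (s.2.symm ⟨m, hm⟩) →
      (freudenthalVertex (fun c => s.1 c - if c = s.2.symm ⟨m, hm⟩ then 1 else 0, r * s.2) 1,
        r.symm * (r * s.2)) = s := by
    intro s hpos
    refine Prod.ext ?_ (by ext d; simp)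
    funext c
    simp only
    rw [freudenthalVertex_mul]
    have h3 : ((r (s.2 c) : Fin n) : ℕ) < 1 ↔ c = s.2.symm ⟨m, hm⟩ := by
      rw [Equiv.eq_symm_apply, ← r.injective.eq_iff (a := s.2 c), hrm, Fin.ext_iff, Fin.val_zero]
      omega
    by_cases h4 : c = s.2.symm ⟨m, hm⟩
    · rw [if_pos h4, if_pos (h3.2 h4)]; rw [← h4] at hpos; omega
    · rw [if_neg h4, if_neg (fun h => h4 (h3.1 h))]; omega
  refine Finset.card_bij' (fun s _ => (freudenthalVertex s 1, r.symm * s.2))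
    (fun s _ => (fun c => s.1 c - if c = s.2.symm ⟨m, hm⟩ then 1 else 0, r * s.2)) ?_ ?_ ?_ ?_
  · intro s hs
    obtain ⟨hs, hl⟩ := Finset.mem_filter.1 hs
    have hs' := mem_freudenthalSimplices.1 hs
    refine Finset.mem_filter.2 ⟨Finset.mem_filter.2 ⟨?_, ?_⟩, ?_⟩
    · rw [mem_freudenthalSimplices]
      intro c
      refine ⟨fun hc => ?_, fun hc => ⟨?_, ?_⟩⟩
      · simp only [freudenthalVertex]
        have := (hs' c).1 hc
        split_ifs with h
        · refine lt_of_le_of_ne this fun hN => ?_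
          have hc' : (c : ℕ) ∈ Finset.range (m + 1) := Finset.mem_range.2 hc
          rw [← hl] at hc'
          obtain ⟨j, hj, hjc⟩ := Finset.mem_image.1 hc'
          refine h1 _ c ?_ hjc
          have hj0 := Finset.ne_of_mem_erase hj
          simp only [freudenthalVertex]
          rw [if_pos (by omega), hN]
        · omega
      · simp only [freudenthalVertex]
        rw [((hs' c).2 hc).1, ((hs' c).2 hc).2, if_neg (by omega)]
      · simp only [Equiv.Perm.mul_apply]
        rw [((hs' c).2 hc).2, hrsgt _ (by omega)]
    · rw [← hl]
      exact (himg _ _ fun j hj => by rw [hvert s j hj]).symm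
    · have : (s.2.symm 0) = ((r.symm * s.2).symm ⟨m, hm⟩) := by
        rw [← Equiv.Perm.inv_def, ← Equiv.Perm.inv_def, mul_inv_rev, Equiv.Perm.mul_apply, ← hrm]
        rfl
      simp only
      rw [← this]
      simp only [freudenthalVertex]
      rw [if_pos (by simp)]; omega
  · intro s hs
    obtain ⟨hs, hpos⟩ := Finset.mem_filter.1 hs
    obtain ⟨hs, hl⟩ := Finset.mem_filter.1 hs
    have hs' := mem_freudenthalSimplices.1 hs
    refine Finset.mem_filter.2 ⟨?_, ?_⟩
    · rw [mem_freudenthalSimplices]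
      intro c
      refine ⟨fun hc => ?_, fun hc => ⟨?_, ?_⟩⟩
      · have := (hs' c).1 hc
        simp only; omega
      · simp only; rw [((hs' c).2 hc).1]; simp
      · simp only [Equiv.Perm.mul_apply]
        rw [((hs' c).2 hc).2, hrgt _ (by omega)]
    · rw [← hl]
      refine himg _ _ fun j hj => ?_
      rw [← hvert _ j hj]
      rw [hback s hpos]
  · intro s hs
    refine Prod.ext ?_ ?_
    · funext c
      simp only [freudenthalVertex]
      have h3 : c = (r.symm * s.2).symm ⟨m, hm⟩ ↔ (s.2 c : ℕ) < 1 := by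
        rw [Equiv.eq_symm_apply, Equiv.Perm.mul_apply, Equiv.symm_apply_eq, hrm, Fin.ext_iff,
          Fin.val_zero]
        omega
      simp only [h3]
      omega
    · ext d; simp
  · intro s hs
    exact hback s (Finset.mem_filter.1 hs).2

/-- If the last step is in direction `d` and the base vanishes there, the facet lies in `x d = 0`
and its labels are at most `d`. The label `m` forces `d = m`, so the facet is a simplex one
dimension lower. -/
theorem filter_labelledFacets_last (hm : m < n) (hN : 0 < N)
    (h0 : ∀ x (c : Fin n), x c = 0 → l x ≤ c) :
    ((labelledFacets N m l (m + 1)).filter fun s => ¬ 0 < s.1 (s.2.symm ⟨m, hm⟩)) =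
      (freudenthalSimplices n N m).filter fun s =>
        (Finset.range (m + 1)).image (fun j => l (freudenthalVertex s j)) =
          Finset.range (m + 1) := by
  have he : (Finset.range (m + 2)).erase (m + 1) = Finset.range (m + 1) := by
    ext j; simp only [Finset.mem_erase, Finset.mem_range]; omega
  ext s
  simp only [labelledFacets, Finset.mem_filter, he, mem_freudenthalSimplices]
  constructor
  · rintro ⟨⟨hs, hl⟩, hz⟩
    refine ⟨fun c => ⟨fun hc => (hs c).1 (by omega), fun hc => ?_⟩, hl⟩
    rcases Nat.lt_or_ge m c with hc' | hc'
    · exact (hs c).2 hc'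
    · have hcm : c = ⟨m, hm⟩ := Fin.ext (le_antisymm hc' hc)
      have hd : m ≤ (s.2.symm ⟨m, hm⟩ : ℕ) := by
        have hmr : m ∈ Finset.range (m + 1) := by simp
        rw [← hl] at hmr
        obtain ⟨j, hj, hjm⟩ := Finset.mem_image.1 hmr
        refine hjm.symm.le.trans (h0 _ _ ?_)
        simp only [freudenthalVertex, Equiv.apply_symm_apply]
        have := Finset.mem_range.1 hj
        rw [if_neg (by omega)]; omega
      have hd' : s.2.symm ⟨m, hm⟩ = ⟨m, hm⟩ := by
        rcases Nat.lt_or_ge m (s.2.symm ⟨m, hm⟩ : ℕ) with h | h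
        · have := ((hs _).2 h).2
          rw [Equiv.apply_symm_apply] at this
          exact this.symm
        · exact Fin.ext (le_antisymm h hd)
      rw [hd'] at hz
      subst hcm
      exact ⟨by omega, by rw [Equiv.symm_apply_eq] at hd'; exact hd'.symm⟩
  · rintro ⟨hs, hl⟩
    have h2 := (hs ⟨m, hm⟩).2 le_rfl
    refine ⟨⟨fun c => ⟨fun hc => ?_, fun hc => (hs c).2 (by omega)⟩, hl⟩, ?_⟩
    · rcases Nat.lt_or_ge c m with hc' | hc'
      · exact (hs c).1 hc'
      · rw [((hs c).2 hc').1]; exact hN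
    · rw [(Equiv.symm_apply_eq _).2 h2.2.symm, h2.1]; simp

/-- **Kuhn's lemma**, with parity: the number of completely labelled simplices is odd. -/
theorem odd_card_fully_labelled (hN : 0 < N) (h0 : ∀ x (c : Fin n), x c = 0 → l x ≤ c)
    (h1 : ∀ x (c : Fin n), x c = N → l x ≠ c) (hl : ∀ x, l x ≤ n) :
    m ≤ n → Odd ((freudenthalSimplices n N m).filter fun s =>
        (Finset.range (m + 1)).image (fun j => l (freudenthalVertex s j)) =
          Finset.range (m + 1)).card := by
  induction m with
  | zero =>
    intro _
    have : ((freudenthalSimplices n N 0).filter fun s =>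
        (Finset.range (0 + 1)).image (fun j => l (freudenthalVertex s j)) =
          Finset.range (0 + 1)) = {(0, 1)} := by
      ext s
      simp only [Finset.mem_filter, mem_freudenthalSimplices, Finset.mem_singleton]
      constructor
      · rintro ⟨hs, -⟩
        exact Prod.ext (funext fun c => ((hs c).2 (Nat.zero_le _)).1)
          (Equiv.ext fun c => ((hs c).2 (Nat.zero_le _)).2)
      · rintro rfl
        refine ⟨fun c => ⟨fun h => absurd h (Nat.not_lt_zero _), fun _ => ⟨rfl, rfl⟩⟩, ?_⟩
        have : l (freudenthalVertex ((0 : Fin n → ℕ), (1 : Equiv.Perm (Fin n))) 0) = 0 := by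
          rcases Nat.eq_zero_or_pos n with hn | hn
          · have := hl (freudenthalVertex ((0 : Fin n → ℕ), (1 : Equiv.Perm (Fin n))) 0); omega
          · exact Nat.le_zero.1 (h0 _ ⟨0, hn⟩ (by simp [freudenthalVertex]))
        simp [this]
    rw [this]; simp
  | succ m ih =>
    intro hm
    have hm' : m < n := hm
    -- Coordinate `m + 1`, if there is one, vanishes on the simplex and bounds the label; otherwise
    -- `hl` does.
    have hlab : ∀ s ∈ freudenthalSimplices n N (m + 1), ∀ i < m + 2,
        l (freudenthalVertex s i) ≤ m + 1 := by
      intro s hs i hi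
      rcases Nat.lt_or_ge (m + 1) n with h | h
      · apply h0 _ ⟨m + 1, h⟩
        have := ((mem_freudenthalSimplices.1 hs) ⟨m + 1, h⟩).2 le_rfl
        simp only [freudenthalVertex]
        rw [this.1, this.2, if_neg (by simp only; omega)]
      · exact (hl _).trans h
    have hfilter : ((freudenthalSimplices n N (m + 1)).filter fun s =>
        (Finset.range (m + 1 + 1)).image (fun j => l (freudenthalVertex s j)) =
          Finset.range (m + 1 + 1)) =
        (freudenthalSimplices n N (m + 1)).filter fun s =>
          Odd ((Finset.range (m + 2)).filter fun i =>
            ((Finset.range (m + 2)).erase i).image (fun j => l (freudenthalVertex s j)) =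
              Finset.range (m + 1)).card :=
      Finset.filter_congr fun s hs => (odd_card_facets_iff (hlab s hs)).symm
    -- Pairs of a simplex and a suitably labelled facet are counted both ways modulo 2. Interior
    -- facets contribute an even number; the facets opposite vertex `0` cancel against the last
    -- facets with positive base coordinate, leaving the count in dimension `m`.
    rw [hfilter, ← Finset.odd_sum_iff_odd_card_odd]
    have hswap := Finset.sum_card_bipartiteAbove_eq_sum_card_bipartiteBelow
      (s := freudenthalSimplices n N (m + 1)) (t := Finset.range (m + 2))
      (fun s i => ((Finset.range (m + 2)).erase i).image (fun j => l (freudenthalVertex s j)) =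
              Finset.range (m + 1))
    simp only [Finset.bipartiteAbove, Finset.bipartiteBelow] at hswap
    rw [hswap]
    change Odd (∑ i ∈ Finset.range (m + 2), (labelledFacets N m l i).card)
    rw [Finset.sum_range_succ, Finset.sum_range_succ']
    have hmid : Even (∑ i ∈ Finset.range m, (labelledFacets N m l (i + 1)).card) :=
      Finset.even_sum _ fun i hi =>
        even_card_labelledFacets hm' (Nat.succ_pos _) (by have := Finset.mem_range.1 hi; omega)
    have hsplit := Finset.card_filter_add_card_filter_not (s := labelledFacets N m l (m + 1))
      (fun s => 0 < s.1 (s.2.symm ⟨m, hm'⟩))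
    rw [filter_labelledFacets_last hm' hN h0, ← card_labelledFacets_zero hm' h1] at hsplit
    have hodd := ih (by omega)
    rw [← hsplit]
    rw [Nat.odd_iff] at hodd ⊢
    rw [Nat.even_iff] at hmid
    omega

/-- **Kuhn's lemma**: there is a completely labelled simplex in the grid. -/
theorem exists_fully_labelled (hN : 0 < N) (h0 : ∀ x (c : Fin n), x c = 0 → l x ≤ c)
    (h1 : ∀ x (c : Fin n), x c = N → l x ≠ c) (hl : ∀ x, l x ≤ n) :
    ∃ v : Fin n → ℕ, ∀ k ≤ n, ∃ w : Fin n → ℕ,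
      (∀ c, v c ≤ w c ∧ w c ≤ v c + 1) ∧ l w = k := by
  obtain ⟨s, hs⟩ := Finset.card_pos.1 (odd_card_fully_labelled hN h0 h1 hl le_rfl).pos
  obtain ⟨-, hs⟩ := Finset.mem_filter.1 hs
  refine ⟨s.1, fun k hk => ?_⟩
  have hk' : k ∈ Finset.range (n + 1) := Finset.mem_range.2 (by omega)
  rw [← hs] at hk'
  obtain ⟨j, -, hj⟩ := Finset.mem_image.1 hk'
  refine ⟨_, fun c => ?_, hj⟩
  simp only [freudenthalVertex]
  split_ifs <;> omega

end Facets

/-! ### Essentiality of the opposite faces of cubes. -/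

/-- The point of the unit cube with coordinates `x c / N`. -/
noncomputable def gridPoint {n : ℕ} (N : ℕ) (x : Fin n → ℕ) : Fin n → I :=
  fun c => projIcc 0 1 zero_le_one ((x c : ℝ) / N)

theorem gridPoint_eq_zero {n N : ℕ} {x : Fin n → ℕ} {c : Fin n} (h : x c = 0) :
    gridPoint N x c = 0 := by
  simp only [gridPoint, h, Nat.cast_zero, zero_div]
  exact projIcc_left _

theorem gridPoint_eq_one {n N : ℕ} (hN : 0 < N) {x : Fin n → ℕ} {c : Fin n} (h : x c = N) :
    gridPoint N x c = 1 := by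
  simp only [gridPoint, h]
  rw [div_self (by positivity)]
  exact projIcc_right _

theorem dist_gridPoint_le {n N : ℕ} {v w : Fin n → ℕ} (h : ∀ c, v c ≤ w c ∧ w c ≤ v c + 1) :
    dist (gridPoint N v) (gridPoint N w) ≤ 1 / N := by
  refine (dist_pi_le_iff (by positivity)).2 fun c => ?_
  have h1 := (LipschitzWith.projIcc (zero_le_one (α := ℝ))).dist_le_mul ((v c : ℝ) / N) ((w c : ℝ) / N)
  refine h1.trans ?_
  rw [NNReal.coe_one, one_mul, Real.dist_eq, ← sub_div, abs_div, Nat.abs_cast]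
  have h2 : (v c : ℝ) ≤ w c := by exact_mod_cast (h c).1
  have h3 : (w c : ℝ) ≤ v c + 1 := by exact_mod_cast (h c).2
  gcongr
  rw [abs_le]; constructor <;> linarith

theorem IsPartitionBetween.preimage {X Y : Type*} [TopologicalSpace X] [TopologicalSpace Y]
    {L A B : Set Y} (h : IsPartitionBetween L A B) {g : X → Y} (hg : Continuous g) {A' B' : Set X}
    (hA : A' ⊆ g ⁻¹' A) (hB : B' ⊆ g ⁻¹' B) : IsPartitionBetween (g ⁻¹' L) A' B' := by
  obtain ⟨hL, U, V, hU, hV, hd, hAU, hBV, hc⟩ := h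
  exact ⟨hL.preimage hg, g ⁻¹' U, g ⁻¹' V, hU.preimage hg, hV.preimage hg, hd.preimage g,
    hA.trans (preimage_mono hAU), hB.trans (preimage_mono hBV), by
      rw [← preimage_compl, hc, preimage_union]⟩

/-- The pairs of opposite faces of a finite-dimensional cube form an essential family. -/
theorem iInter_partitions_fin_cube_nonempty {n : ℕ} (L : Fin n → Set (Fin n → I))
    (h : ∀ k, IsPartitionBetween (L k) {x | x k = 0} {x | x k = 1}) : (⋂ k, L k).Nonempty := by
  classical
  choose hL U V hU hV hd hA hB hc using h
  -- The label of a grid point is the least `k` for which it lies in `U k`, and `n` if there is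
  -- none.
  have hex : ∀ (N : ℕ) (x : Fin n → ℕ),
      ∃ k : ℕ, k = n ∨ ∃ hk : k < n, gridPoint N x ∈ U ⟨k, hk⟩ := fun _ _ => ⟨n, Or.inl rfl⟩
  have key : ∀ N : ℕ, ∃ v : Fin n → ℕ, ∀ k ≤ n, ∃ w : Fin n → ℕ,
      (∀ c, v c ≤ w c ∧ w c ≤ v c + 1) ∧ Nat.find (hex (N + 1) w) = k := by
    intro N
    apply exists_fully_labelled (l := fun x => Nat.find (hex (N + 1) x)) (Nat.succ_pos N)
    · intro x c hx
      exact Nat.find_min' _ (Or.inr ⟨c.2, hA c (gridPoint_eq_zero hx)⟩)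
    · intro x c hx hlab
      rcases (Nat.find_eq_iff _).1 hlab with ⟨hcn | ⟨hcn, hmem⟩, -⟩
      · exact c.2.ne hcn
      · exact disjoint_left.1 (hd c) hmem (hB c (gridPoint_eq_one (Nat.succ_pos N) hx))
    · intro x
      exact Nat.find_min' _ (Or.inl rfl)
  choose v hv using key
  obtain ⟨p, φ, hφ, hp⟩ := CompactSpace.tendsto_subseq fun N => gridPoint (N + 1) (v N)
  -- The completely labelled simplices shrink to `p`, so every label occurs arbitrarily close to
  -- `p`.
  have hlim : ∀ k ≤ n, ∃ w : ℕ → Fin n → ℕ,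
      (∀ N, Nat.find (hex (φ N + 1) (w N)) = k) ∧
      Filter.Tendsto (fun N => gridPoint (φ N + 1) (w N)) Filter.atTop (nhds p) := by
    intro k hk
    choose w hw hwk using fun N => hv (φ N) k hk
    refine ⟨w, hwk, tendsto_of_tendsto_of_dist hp ?_⟩
    have h1 : Filter.Tendsto (fun N : ℕ => 1 / ((φ N : ℝ) + 1)) Filter.atTop (nhds 0) :=
      tendsto_one_div_add_atTop_nhds_zero_nat.comp hφ.tendsto_atTop
    refine squeeze_zero (fun _ => dist_nonneg) (fun N => ?_) h1
    have := dist_gridPoint_le (N := φ N + 1) (hw N)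
    push_cast at this
    exact this
  refine ⟨p, mem_iInter.2 fun k => ?_⟩
  by_contra hpk
  have hpk : p ∈ U k ∪ V k := by rw [← hc]; exact hpk
  rcases hpk with hpk | hpk
  -- Points labelled `n` lie outside every `U k`, so they cannot approach a point of `U k`.
  · obtain ⟨w, hw, hwp⟩ := hlim n le_rfl
    obtain ⟨N, hN⟩ := (hwp.eventually_mem ((hU k).mem_nhds hpk)).exists
    have := Nat.find_min' (hex (φ N + 1) (w N)) (Or.inr ⟨k.2, hN⟩)
    rw [hw N] at this
    exact absurd k.2 (not_lt.2 this)
  -- Points labelled `k` lie in `U k`, so they cannot approach a point of `V k`.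
  · obtain ⟨w, hw, hwp⟩ := hlim k k.2.le
    obtain ⟨N, hN⟩ := (hwp.eventually_mem ((hV k).mem_nhds hpk)).exists
    rcases (Nat.find_eq_iff _).1 (hw N) with ⟨hcn | ⟨hcn, hmem⟩, -⟩
    · exact k.2.ne hcn
    · exact disjoint_left.1 (hd k) hmem hN

/-- The pairs of opposite faces of a cube of arbitrary dimension form an essential family. -/
theorem iInter_partitions_cube_nonempty {ι : Type*} (L : ι → Set (ι → I))
    (h : ∀ k, IsPartitionBetween (L k) {x | x k = 0} {x | x k = 1}) : (⋂ k, L k).Nonempty := by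
  classical
  have := isCompact_univ.inter_iInter_nonempty (X := ι → I) L (fun k => (h k).1) ?_
  · rwa [univ_inter] at this
  intro s
  set e := s.equivFin
  -- The finite cube is embedded as the face whose coordinates outside `s` are `0`, and the
  -- partitions are pulled back.
  let g : (Fin s.card → I) → ι → I := fun x k => if hk : k ∈ s then x (e ⟨k, hk⟩) else 0
  have hg : Continuous g := by
    refine continuous_pi fun k => ?_
    by_cases hk : k ∈ s
    · simp only [g, hk, dite_true]; exact continuous_apply _
    · simp only [g, hk, dite_false]; exact continuous_const
  have hge : ∀ (x : Fin s.card → I) (j : Fin s.card), g x (e.symm j : ι) = x j := by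
    intro x j
    simp [g]
  obtain ⟨x, hx⟩ := iInter_partitions_fin_cube_nonempty (fun j => g ⁻¹' L (e.symm j : ι))
    fun j => (h _).preimage hg (fun x hx => (hge x j).trans hx) (fun x hx => (hge x j).trans hx)
  refine ⟨g x, mem_univ _, mem_iInter₂.2 fun k hk => ?_⟩
  have := mem_iInter.1 hx (e ⟨k, hk⟩)
  rwa [Equiv.symm_apply_apply] at this

/-! ### Extending partitions and passing to subfamilies. -/

/-- Every partition in a closed subspace of a completely normal space contains the trace of a
partition in the whole space. -/
theorem IsPartitionBetween.exists_extension {Q : Type*} [TopologicalSpace Q]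
    [CompletelyNormalSpace Q] {X A B : Set Q} (hX : IsClosed X) (hA : IsClosed A)
    (hB : IsClosed B) (hAB : Disjoint A B) {L A' B' : Set X} (h : IsPartitionBetween L A' B')
    (hA' : Subtype.val ⁻¹' A ⊆ A') (hB' : Subtype.val ⁻¹' B ⊆ B') :
    ∃ L' : Set Q, IsPartitionBetween L' A B ∧ Subtype.val ⁻¹' L' ⊆ L := by
  obtain ⟨-, U, V, hU, hV, hd, hAU, hBV, hc⟩ := h
  -- `U ∪ A` and `V ∪ B` are separated in `Q`: `U` and `V` are disjoint and relatively open, and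
  -- since `X` is closed, `closure U` meets `B` only inside `X`, where the trace of `B` lies in `V`.
  have aux : ∀ {U V : Set X}, IsOpen V → Disjoint U V →
      ∀ {A B : Set Q}, IsClosed A → Disjoint A B → Subtype.val ⁻¹' A ⊆ U →
      Subtype.val ⁻¹' B ⊆ V →
      Disjoint (closure (Subtype.val '' U ∪ A)) (Subtype.val '' V ∪ B) := by
    intro U V hV hd A B hA hAB hAU hBV
    have h1 : ∀ x : X, x ∈ V → (x : Q) ∉ closure (Subtype.val '' U) := by
      intro x hx hcl
      obtain ⟨W, hW, rfl⟩ := isOpen_induced_iff.1 hV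
      obtain ⟨_, hyW, y, hyU, rfl⟩ := mem_closure_iff.1 hcl W hW hx
      exact disjoint_left.1 hd hyU hyW
    rw [closure_union, hA.closure_eq, disjoint_left]
    rintro x (hx | hx) (⟨y, hy, rfl⟩ | hxB)
    · exact h1 y hy hx
    · have hxX : x ∈ X :=
        hX.closure_subset_iff.2 (Subtype.coe_image_subset X U) hx
      exact h1 ⟨x, hxX⟩ (hBV hxB) hx
    · exact disjoint_left.1 hd (hAU hx) hy
    · exact disjoint_left.1 hAB hx hxB
  have hsep : SeparatedNhds (Subtype.val '' U ∪ A) (Subtype.val '' V ∪ B) := by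
    rw [separatedNhds_iff_disjoint]
    exact CompletelyNormalSpace.completely_normal
      (aux hV hd hA hAB (hA'.trans hAU) (hB'.trans hBV))
      (aux hU hd.symm hB hAB.symm (hB'.trans hBV) (hA'.trans hAU)).symm
  obtain ⟨U', V', hU', hV', hUU', hVV', hd'⟩ := hsep
  refine ⟨(U' ∪ V')ᶜ, ⟨(hU'.union hV').isClosed_compl, U', V', hU', hV', hd',
    subset_union_right.trans hUU', subset_union_right.trans hVV', compl_compl _⟩, ?_⟩
  intro x hx
  by_contra hxL
  have : x ∈ U ∪ V := by rw [← hc]; exact hxL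
  rcases this with hxU | hxV
  · exact hx (Or.inl (hUU' (Or.inl (mem_image_of_mem _ hxU))))
  · exact hx (Or.inr (hVV' (Or.inl (mem_image_of_mem _ hxV))))

/-- Indices outside the range of `g` receive the arbitrary partitions provided by `hp`. -/
theorem IsEssentialFamily.comp_injective {X ι κ : Type*} [TopologicalSpace X] {A B : ι → Set X}
    (h : IsEssentialFamily A B) (hp : ∀ i, ∃ L, IsPartitionBetween L (A i) (B i))
    {g : κ → ι} (hg : Function.Injective g) :
    IsEssentialFamily (fun j => A (g j)) (fun j => B (g j)) := by
  classical
  refine ⟨fun j => h.1 (g j), fun L hL => ?_⟩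
  choose M hM using hp
  obtain ⟨x, hx⟩ := h.2 (Function.extend g L M) (fun i => by
    by_cases hi : ∃ j, g j = i
    · obtain ⟨j, rfl⟩ := hi
      rw [hg.extend_apply]; exact hL j
    · rw [Function.extend_apply' _ _ _ hi]; exact hM i)
  refine ⟨x, mem_iInter.2 fun j => ?_⟩
  have := mem_iInter.1 hx (g j)
  rwa [hg.extend_apply] at this

/-! ### The crooked partition. -/

theorem closure_Ioo_prod_Ioo {a b c d : I} (h : a < b) (h' : c < d) :
    closure (Ioo a b ×ˢ Ioo c d) = Icc a b ×ˢ Icc c d := by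
  rw [closure_prod_eq, closure_Ioo h.ne, closure_Ioo h'.ne]

theorem seventh_lt_seventh {j k : Fin 8} (h : j < k) : seventh j < seventh k := by
  rw [← Subtype.coe_lt_coe]
  simp only [seventh]
  gcongr
  exact h

section CrookedPartition

variable {y₁ y₂ y₃ y₄ : I}

theorem crookedPartition_eq (h₀ : 0 < y₁) (h₁ : y₁ < y₂) (h₂ : y₂ < y₃) (h₄ : y₃ < y₄)
    (h₅ : y₄ < 1) :
    crookedPartition y₁ y₂ y₃ y₄ =
      Icc (seventh 1) (seventh 2) ×ˢ Icc 0 y₄ ∪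
      Icc (seventh 1) (seventh 4) ×ˢ Icc y₃ y₄ ∪
      Icc (seventh 3) (seventh 4) ×ˢ Icc y₁ y₄ ∪
      Icc (seventh 3) (seventh 6) ×ˢ Icc y₁ y₂ ∪
      Icc (seventh 5) (seventh 6) ×ˢ Icc y₁ 1 := by
  have h : y₁ < y₄ := h₁.trans (h₂.trans h₄)
  rw [crookedPartition]
  simp only [closure_union]
  rw [closure_Ioo_prod_Ioo (seventh_lt_seventh (by decide)) (h₀.trans h),
    closure_Ioo_prod_Ioo (seventh_lt_seventh (by decide)) h₄,
    closure_Ioo_prod_Ioo (seventh_lt_seventh (by decide)) h,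
    closure_Ioo_prod_Ioo (seventh_lt_seventh (by decide)) h₁,
    closure_Ioo_prod_Ioo (seventh_lt_seventh (by decide)) (h.trans h₅)]

theorem mem_crookedPartition (h₀ : 0 < y₁) (h₁ : y₁ < y₂) (h₂ : y₂ < y₃) (h₄ : y₃ < y₄)
    (h₅ : y₄ < 1) {p : I × I} :
    p ∈ crookedPartition y₁ y₂ y₃ y₄ ↔
      (1 / 7 ≤ (p.1 : ℝ) ∧ (p.1 : ℝ) ≤ 2 / 7 ∧ p.2 ≤ y₄) ∨
      (1 / 7 ≤ (p.1 : ℝ) ∧ (p.1 : ℝ) ≤ 4 / 7 ∧ y₃ ≤ p.2 ∧ p.2 ≤ y₄) ∨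
      (3 / 7 ≤ (p.1 : ℝ) ∧ (p.1 : ℝ) ≤ 4 / 7 ∧ y₁ ≤ p.2 ∧ p.2 ≤ y₄) ∨
      (3 / 7 ≤ (p.1 : ℝ) ∧ (p.1 : ℝ) ≤ 6 / 7 ∧ y₁ ≤ p.2 ∧ p.2 ≤ y₂) ∨
      (5 / 7 ≤ (p.1 : ℝ) ∧ (p.1 : ℝ) ≤ 6 / 7 ∧ y₁ ≤ p.2) := by
  rw [crookedPartition_eq h₀ h₁ h₂ h₄ h₅]
  have h0 : (0 : I) ≤ p.2 := nonneg'
  have h1 : p.2 ≤ 1 := le_one'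
  have hl : ∀ k : Fin 8, seventh k ≤ p.1 ↔ ((k : ℕ) : ℝ) / 7 ≤ p.1 := fun _ => Iff.rfl
  have hr : ∀ k : Fin 8, p.1 ≤ seventh k ↔ (p.1 : ℝ) ≤ ((k : ℕ) : ℝ) / 7 := fun _ => Iff.rfl
  simp only [mem_union, mem_prod, mem_Icc, hl, hr, h0, h1, true_and, and_true, and_assoc, or_assoc]
  norm_num [Fin.val_ofNat]

/-- The crooked partition separates the vertical edges of the square. -/
theorem isPartitionBetween_crookedPartition (h₀ : 0 < y₁) (h₁ : y₁ < y₂) (h₂ : y₂ < y₃)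
    (h₄ : y₃ < y₄) (h₅ : y₄ < 1) :
    IsPartitionBetween (crookedPartition y₁ y₂ y₃ y₄) {p | p.1 = 0} {p | p.1 = 1} := by
  have c1 : Continuous fun p : I × I => (p.1 : ℝ) := by fun_prop
  have c2 : Continuous fun p : I × I => (p.2 : ℝ) := by fun_prop
  -- The pocket between the middle and last legs opens upwards and belongs to the left side; the
  -- pocket between the first and middle legs opens downwards and belongs to the right side.
  refine ⟨isClosed_closure,
    {p | (p.1 : ℝ) < 1 / 7} ∪ {p | (p.1 : ℝ) < 5 / 7 ∧ y₄ < p.2} ∪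
      {p | 4 / 7 < (p.1 : ℝ) ∧ (p.1 : ℝ) < 5 / 7 ∧ y₂ < p.2},
    {p | 6 / 7 < (p.1 : ℝ)} ∪ {p | 2 / 7 < (p.1 : ℝ) ∧ p.2 < y₁} ∪
      {p | 2 / 7 < (p.1 : ℝ) ∧ (p.1 : ℝ) < 3 / 7 ∧ p.2 < y₃}, ?_, ?_, ?_, ?_, ?_, ?_⟩
  · exact ((isOpen_lt c1 continuous_const).union
      ((isOpen_lt c1 continuous_const).inter (isOpen_lt continuous_const c2))).union
      ((isOpen_lt continuous_const c1).inter
        ((isOpen_lt c1 continuous_const).inter (isOpen_lt continuous_const c2)))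
  · exact ((isOpen_lt continuous_const c1).union
      ((isOpen_lt continuous_const c1).inter (isOpen_lt c2 continuous_const))).union
      ((isOpen_lt continuous_const c1).inter
        ((isOpen_lt c1 continuous_const).inter (isOpen_lt c2 continuous_const)))
  · rw [disjoint_left]
    rintro p ((hp | ⟨hp, hp'⟩) | ⟨hp, hp', hp''⟩) ((hq | ⟨hq, hq'⟩) | ⟨hq, hq', hq''⟩) <;>
    simp only [mem_ofPred_eq, ← Subtype.coe_lt_coe] at * <;> linarith
  · intro p hp
    have hp : p.1 = 0 := hp
    simp [hp]
  · intro p hp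
    have hp : p.1 = 1 := hp
    refine Or.inl (Or.inl ?_)
    simp only [mem_ofPred_eq, hp, Icc.coe_one]; norm_num
  · ext p
    rw [mem_compl_iff, mem_crookedPartition h₀ h₁ h₂ h₄ h₅]
    simp only [mem_union, mem_ofPred_eq]
    simp only [← Subtype.coe_lt_coe, ← Subtype.coe_le_coe] at *
    grind

end CrookedPartition

/-! ### Hereditary indecomposability of the compactum. -/

theorem continuous_diagMap (f : ℕ+ → C(HilbertCube, I)) (i : ℕ+) : Continuous (diagMap f i) :=
  (continuous_apply _).prodMk (f i).continuous

theorem isClosed_bingCompactum {P : Set (I × I)} (hP : IsClosed P)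
    (f : ℕ+ → C(HilbertCube, I)) : IsClosed (bingCompactum P f) :=
  isClosed_iInter fun i => hP.preimage (continuous_diagMap f i)

/-- A preconnected set on which a continuous function avoids `(a, b)` and that has a point where
the function is at most `a` lies in the set where the function is at most `a`. -/
theorem IsPreconnected.forall_le_of_gap {X : Type*} [TopologicalSpace X] {K : Set X}
    (hK : IsPreconnected K) {g : X → ℝ} (hg : ContinuousOn g K) {a b : ℝ} (hab : a < b)
    (hgap : ∀ x ∈ K, g x ≤ a ∨ b ≤ g x) {p : X} (hp : p ∈ K) (hpa : g p ≤ a) :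
    ∀ x ∈ K, g x ≤ a := by
  intro x hx
  by_contra! hxa
  have hxb : b ≤ g x := (hgap x hx).resolve_left hxa.not_ge
  obtain ⟨y, hy, hya⟩ := hK.intermediate_value hp hx hg
    (show (a + b) / 2 ∈ Icc (g p) (g x) by constructor <;> linarith)
  rcases hgap y hy with h | h <;> linarith

theorem IsPreconnected.forall_ge_of_gap {X : Type*} [TopologicalSpace X] {K : Set X}
    (hK : IsPreconnected K) {g : X → ℝ} (hg : ContinuousOn g K) {a b : ℝ} (hab : a < b)
    (hgap : ∀ x ∈ K, g x ≤ a ∨ b ≤ g x) {p : X} (hp : p ∈ K) (hpb : b ≤ g p) :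
    ∀ x ∈ K, b ≤ g x := by
  intro x hx
  have := hK.forall_le_of_gap (g := fun x => -g x) hg.neg (neg_lt_neg hab)
    (fun x hx => (hgap x hx).symm.imp neg_le_neg neg_le_neg) hp (neg_le_neg hpb) x hx
  linarith

section BingCompactum

variable {y₁ y₂ y₃ y₄ : I} {f : ℕ+ → C(HilbertCube, I)}

/-- Two continua in the compactum of crooked partitions that meet are comparable. -/
theorem subset_or_subset_of_subset_bingCompactum (h₀ : 0 < y₁) (h₁ : y₁ < y₂)
    (h₂ : (y₂ : ℝ) < 1 / 2) (h₃ : 1 / 2 < (y₃ : ℝ)) (h₄ : y₃ < y₄) (h₅ : y₄ < 1)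
    (hf : IsPliableFamily f) {K L : Set HilbertCube}
    (hKX : K ⊆ bingCompactum (crookedPartition y₁ y₂ y₃ y₄) f)
    (hLX : L ⊆ bingCompactum (crookedPartition y₁ y₂ y₃ y₄) f)
    (hK : IsClosed K) (hKc : IsPreconnected K) (hL : IsClosed L) (hLc : IsPreconnected L)
    (hKL : (K ∩ L).Nonempty) : K ⊆ L ∨ L ⊆ K := by
  by_contra! h
  obtain ⟨p, hpK, hpL⟩ := not_subset.1 h.1
  obtain ⟨q, hqL, hqK⟩ := not_subset.1 h.2
  obtain ⟨i, hC, hG, hF, hD⟩ := hf {p} {q} L K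
    ⟨isClosed_singleton, isClosed_singleton, hL, hK,
      singleton_inter_eq_empty.2 fun h => hpL (mem_singleton_iff.1 h ▸ hqL),
      singleton_inter_eq_empty.2 hpL, singleton_inter_eq_empty.2 hqK⟩
    (singleton_nonempty p) (singleton_nonempty q)
  rw [image_singleton, singleton_eq_singleton_iff] at hC hD
  have h₂₃ : y₂ < y₃ := Subtype.coe_lt_coe.1 (h₂.trans h₃)
  have hmem : ∀ x ∈ bingCompactum (crookedPartition y₁ y₂ y₃ y₄) f,
      diagMap f i x ∈ crookedPartition y₁ y₂ y₃ y₄ := fun x hx => mem_iInter.1 hx i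
  simp only [mem_crookedPartition h₀ h₁ h₂₃ h₄ h₅, diagMap, ← Subtype.coe_le_coe] at hmem
  simp only [← Subtype.coe_lt_coe, Icc.coe_zero, Icc.coe_one] at h₀ h₁ h₄ h₅
  have hcont : Continuous fun x : HilbertCube => (x (2 * i) : ℝ) := by fun_prop
  -- At heights up to `1/2` the band has no point over `(2/7, 3/7)`, and only its first leg reaches
  -- height `0`.
  have hKle : ∀ x ∈ K, (x (2 * i) : ℝ) ≤ 2 / 7 := by
    refine hKc.forall_le_of_gap hcont.continuousOn (b := 3 / 7) (by norm_num) ?_ hpK ?_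
    · intro x hx
      have := hG x hx
      rcases hmem x (hKX hx) with h | h | h | h | h
      · exact Or.inl h.2.1
      · linarith
      · exact Or.inr h.1
      · exact Or.inr h.1
      · exact Or.inr (by linarith)
    · have := hmem p (hKX hpK)
      rw [hC, Icc.coe_zero] at this
      rcases this with h | h | h | h | h <;> linarith
  -- At heights from `1/2` on the band has no point over `(4/7, 5/7)`, and only its last leg reaches
  -- height `1`.
  have hLge : ∀ x ∈ L, 5 / 7 ≤ (x (2 * i) : ℝ) := by
    refine hLc.forall_ge_of_gap hcont.continuousOn (a := 4 / 7) (by norm_num) ?_ hqL ?_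
    · intro x hx
      have := hF x hx
      rcases hmem x (hLX hx) with h | h | h | h | h
      · exact Or.inl (by linarith)
      · exact Or.inl h.2.1
      · exact Or.inl h.2.1
      · linarith
      · exact Or.inr h.1
    · have := hmem q (hLX hqL)
      rw [hD, Icc.coe_one] at this
      rcases this with h | h | h | h | h <;> linarith
  obtain ⟨r, hrK, hrL⟩ := hKL
  linarith [hKle r hrK, hLge r hrL]

/-! ### Essentiality of the odd faces. -/

theorem disjoint_faceTraces (Y : Set HilbertCube) (k : ℕ+) :
    IsClosed (faceZeroTrace Y k) ∧ IsClosed (faceOneTrace Y k) ∧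
      Disjoint (faceZeroTrace Y k) (faceOneTrace Y k) := by
  have hc : Continuous fun x : Y => x.1 k := (continuous_apply k).comp continuous_subtype_val
  refine ⟨isClosed_singleton.preimage hc, isClosed_singleton.preimage hc, disjoint_left.2 ?_⟩
  intro x h0 h1
  exact zero_ne_one ((show x.1 k = 0 from h0).symm.trans h1)

/-- Supplies the filler partitions for `IsEssentialFamily.comp_injective`. -/
theorem isPartitionBetween_preimage_half {X : Type*} [TopologicalSpace X] {g : X → I}
    (hg : Continuous g) :
    IsPartitionBetween {x | (g x : ℝ) = 1 / 2} {x | g x = 0} {x | g x = 1} := by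
  have hg' : Continuous fun x => (g x : ℝ) := by fun_prop
  refine ⟨isClosed_eq hg' continuous_const, {x | (g x : ℝ) < 1 / 2}, {x | 1 / 2 < (g x : ℝ)},
    isOpen_lt hg' continuous_const, isOpen_lt continuous_const hg', ?_, ?_, ?_, ?_⟩
  · exact disjoint_left.2 fun x h h' => lt_asymm (show (g x : ℝ) < 1 / 2 from h) h'
  · intro x hx
    have hx : g x = 0 := hx
    simp [hx]
  · intro x hx
    have hx : g x = 1 := hx
    simp only [mem_ofPred_eq, hx, Icc.coe_one]; norm_num
  · ext x
    exact ne_iff_lt_or_gt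

/-- The traces of the odd-numbered faces form an essential family in the intersection of
preimages of a partition between the vertical edges of the square. -/
theorem isEssentialFamily_odd_faceTraces {P : Set (I × I)}
    (hP : IsPartitionBetween P {p | p.1 = 0} {p | p.1 = 1}) :
    IsEssentialFamily
      (fun k : {k : ℕ+ // Odd (k : ℕ)} => faceZeroTrace (bingCompactum P f) k)
      (fun k : {k : ℕ+ // Odd (k : ℕ)} => faceOneTrace (bingCompactum P f) k) := by
  classical
  refine ⟨fun k => disjoint_faceTraces _ _, fun L hL => ?_⟩
  -- A compatible metric makes the cube completely normal, as `IsPartitionBetween.exists_extension`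
  -- requires.
  let _ : MetricSpace HilbertCube := TopologicalSpace.metrizableSpaceMetric HilbertCube
  have hface : ∀ (k : ℕ+) (a : I), IsClosed {x : HilbertCube | x k = a} := fun k a =>
    isClosed_singleton.preimage (continuous_apply k)
  choose M hM hML using fun k => (hL k).exists_extension (isClosed_bingCompactum hP.1 f)
    (hface k 0) (hface k 1)
    (disjoint_left.2 fun x (h0 : x k = 0) (h1 : x k = 1) => zero_ne_one (h0.symm.trans h1))
    (fun _ hx => hx) (fun _ hx => hx)
  have heven : ∀ k : ℕ+, ¬ Odd (k : ℕ) → ∃ i : ℕ+, k = 2 * i := by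
    intro k hk
    obtain ⟨j, hj⟩ := even_iff_two_dvd.1 (Nat.not_odd_iff_even.1 hk)
    exact ⟨⟨j, by have := k.pos; omega⟩, PNat.eq hj⟩
  have hev : ∀ i : ℕ+, ¬ Odd ((2 * i : ℕ+) : ℕ) := fun i => by
    rw [Nat.not_odd_iff_even]; exact ⟨i, by push_cast; ring⟩
  choose half hhalf using heven
  -- The even members of `N` put a common point into the compactum; the odd members put it into
  -- every `L k`.
  let N : ℕ+ → Set HilbertCube := fun k =>
    if hk : Odd (k : ℕ) then M ⟨k, hk⟩ else diagMap f (half k hk) ⁻¹' P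
  obtain ⟨x, hx⟩ := iInter_partitions_cube_nonempty N fun k => by
    by_cases hk : Odd (k : ℕ)
    · simp only [N, hk, dite_true]; exact hM ⟨k, hk⟩
    · simp only [N, hk, dite_false]
      have h2 := (hhalf k hk).symm
      refine hP.preimage (continuous_diagMap f _) ?_ ?_ <;>
      · intro x hx
        simp only [mem_preimage, mem_ofPred_eq, diagMap, h2]
        exact hx
  have hxN : ∀ k, x ∈ N k := mem_iInter.1 hx
  have hxX : x ∈ bingCompactum P f := by
    refine mem_iInter.2 fun i => ?_
    have h1 := hxN (2 * i)
    have h2 : half (2 * i) (hev i) = i := (mul_left_cancel (hhalf (2 * i) (hev i))).symm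
    simp only [N, hev i, dite_false, h2] at h1
    exact h1
  refine ⟨⟨x, hxX⟩, mem_iInter.2 fun k => hML k ?_⟩
  have h1 := hxN k
  simp only [N, k.2, dite_true] at h1
  exact h1

end BingCompactum

theorem infinite_odd_pnat : Infinite {k : ℕ+ // Odd (k : ℕ)} := by
  refine Infinite.of_injective
    (fun n : ℕ => (⟨⟨2 * n + 1, Nat.succ_pos _⟩, ⟨n, rfl⟩⟩ : {k : ℕ+ // Odd (k : ℕ)})) ?_
  intro a b h
  have h := congrArg (fun k : {k : ℕ+ // Odd (k : ℕ)} => ((k : ℕ+) : ℕ)) h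
  simp only [PNat.mk_coe] at h
  omega

theorem mainTheorem4
    (y₁ y₂ y₃ y₄ : I) (h₀ : 0 < y₁) (h₁ : y₁ < y₂) (h₂ : (y₂ : ℝ) < 1 / 2)
    (h₃ : 1 / 2 < (y₃ : ℝ)) (h₄ : y₃ < y₄) (h₅ : y₄ < 1)
    (f : ℕ+ → C(HilbertCube, I)) (hf : IsPliableFamily f)
    (X : Set HilbertCube) (hX : X = bingCompactum (crookedPartition y₁ y₂ y₃ y₄) f) :
    IsCompact X ∧ HereditarilyIndecomposable X ∧
      InfiniteDimensional X ∧
      IsEssentialFamily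
        (fun k : {k : ℕ+ // Odd (k : ℕ)} => faceZeroTrace X k)
        (fun k : {k : ℕ+ // Odd (k : ℕ)} => faceOneTrace X k) ∧
      StronglyInfiniteDimensional X := by
  have hP := isPartitionBetween_crookedPartition h₀ h₁ (Subtype.coe_lt_coe.1 (h₂.trans h₃)) h₄ h₅
  have hcompact : IsCompact X := hX ▸ (isClosed_bingCompactum hP.1 f).isCompact
  have hess : IsEssentialFamily
      (fun k : {k : ℕ+ // Odd (k : ℕ)} => faceZeroTrace X k)
      (fun k : {k : ℕ+ // Odd (k : ℕ)} => faceOneTrace X k) :=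
    hX ▸ isEssentialFamily_odd_faceTraces hP
  have hinf := infinite_odd_pnat
  refine ⟨hcompact, ⟨isCompact_iff_compactSpace.1 hcompact, inferInstance, ?_⟩, ?_, hess,
    ⟨_, _, _, hinf, hess⟩⟩
  · intro K L hK hKc hL hLc hKL
    have himage : ∀ S : Set X, Subtype.val '' S ⊆ bingCompactum (crookedPartition y₁ y₂ y₃ y₄) f :=
      fun S => (Subtype.coe_image_subset X S).trans hX.subset
    have := subset_or_subset_of_subset_bingCompactum h₀ h₁ h₂ h₃ h₄ h₅ hf
      (himage K) (himage L)
      (hK.image continuous_subtype_val).isClosed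
      (hKc.image _ continuous_subtype_val.continuousOn).isPreconnected
      (hL.image continuous_subtype_val).isClosed
      (hLc.image _ continuous_subtype_val.continuousOn).isPreconnected
      (by rw [← image_inter Subtype.val_injective]; exact hKL.image _)
    rwa [image_subset_image_iff Subtype.val_injective,
      image_subset_image_iff Subtype.val_injective] at this
  · intro n
    refine ⟨_, _, hess.comp_injective (fun k => ⟨_, isPartitionBetween_preimage_half
      ((continuous_apply (k : ℕ+)).comp continuous_subtype_val)⟩)
      (g := fun j : Fin n => Infinite.natEmbedding _ j) ?_⟩
    exact (Infinite.natEmbedding _).injective.comp Fin.val_injective
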